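/- Graphs are finite; loops and parallel edges are permitted. A graph is cubic if every vertex has degree $3$, where a loop contributes $2$ to the degree of its vertex. A decycling set of a graph $G$ is a set $J\subseteq V(G)$ such that $G-J$ contains no cycle (a loop is a cycle of length $1$ and a pair of parallel edges is a cycle of length $2$), and the decycling number $\phi(G)$ is the smallest size of a decycling set of $G$. Let $G$ be a connected graph with Betti number $\beta(G)=|E(G)|-|V(G)|+1$. Its maximum genus $\gamma_M(G)$ is the largest genus of a closed orientable surface on which $G$ has a cellular embedding. Here a cellular embedding on a closed oriented surface is given, as usual, by its rotation system, that is, by a cyclic ordering of the half-edges at each vertex; the faces are the closed walks obtained by face tracing (after traversing an edge, continue with the next half-edge in the cyclic ordering at the vertex reached; a single vertex without edges is embedded on the sphere with one face), and the genus $g$ is given by the Euler–Poincaré equation $|V(G)|-|E(G)|+r=2-2g$, where $r$ is the number of faces. The graph $G$ is upper-embeddable if $\gamma_M(G)=\lfloor\beta(G)/2\rfloor$. **Theorem.** If $G$ is a connected cubic graph of order $n$ (that is, with $n$ vertices), then $$\phi(G)\ \ge\ \left\lceil\frac{n+2}{4}\right\rceil,$$ and equality holds if and only if $G$ is upper-embeddable.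 -/

import Mathlib

/-!
Graphs are Mathlib's `Graph α β`: vertices are taken from `α`, edges from `β`, and loops and
parallel edges are permitted.
-/

namespace Graph

universe u v

/-- The degree of the vertex `x`: the number of edges incident with `x`, loops being counted
twice. -/
noncomputable def vertexDegree {α : Type u} {β : Type v} (G : Graph α β) (x : α) : ℕ∞ :=
  (G.incidenceSet x).encard + (G.loopSet x).encard

/-- A graph is cubic if all its vertices have degree `3`. -/
def IsCubic {α : Type u} {β : Type v} (G : Graph α β) : Prop :=
  ∀ x ∈ G.vertexSet, G.vertexDegree x = 3

/-- A graph is connected if it has a vertex and any two of its vertices are joined by a walk. -/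
def IsConnected {α : Type u} {β : Type v} (G : Graph α β) : Prop :=
  G.vertexSet.Nonempty ∧
    ∀ x ∈ G.vertexSet, ∀ y ∈ G.vertexSet, Relation.ReflTransGen G.Adj x y

/-- `G` contains a cycle: for some `k ≥ 1` there are `k` distinct vertices `x i` and `k` distinct
edges `e i` such that `e i` joins `x i` to its cyclic successor. Thus a loop is a cycle of
length `1`, and two parallel edges form a cycle of length `2`. -/
def HasCycle {α : Type u} {β : Type v} (G : Graph α β) : Prop :=
  ∃ (k : ℕ) (_ : NeZero k) (x : Fin k → α) (e : Fin k → β),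
    Function.Injective x ∧ Function.Injective e ∧ ∀ i, G.IsLink (e i) (x i) (x (i + 1))

/-- `J` is a decycling set of `G`: a set of vertices whose removal leaves an acyclic graph. -/
def IsDecyclingSet {α : Type u} {β : Type v} (G : Graph α β) (J : Set α) : Prop :=
  J ⊆ G.vertexSet ∧ ¬ (G.deleteVerts J).HasCycle

/-- The decycling number `φ(G)` of a finite graph: the smallest size of a decycling set.
(The set of sizes is not empty, because the whole vertex set is a decycling set.) -/
noncomputable def decyclingNumber {α : Type u} {β : Type v} (G : Graph α β) : ℕ :=
  sInf {k : ℕ | ∃ J : Set α, G.IsDecyclingSet J ∧ J.ncard = k}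

/-- The Betti number (cycle rank) `|E| - |V| + 1` of a finite connected graph. -/
noncomputable def bettiNumber {α : Type u} {β : Type v} (G : Graph α β) : ℤ :=
  (G.edgeSet.ncard : ℤ) - (G.vertexSet.ncard : ℤ) + 1

/-- The darts (half-edges) of a graph: every edge `e`, loop or not, consists of the two darts
`(e, false)` and `(e, true)`. -/
abbrev HalfEdge {α : Type u} {β : Type v} (G : Graph α β) : Type v :=
  ↥G.edgeSet × Bool

/-- The involution that interchanges the two darts of every edge. -/
def halfEdgeFlip {α : Type u} {β : Type v} (G : Graph α β) : Equiv.Perm G.HalfEdge :=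
  Equiv.prodCongr (Equiv.refl _) Equiv.boolNot

/-- A cellular embedding of a finite connected graph on a closed oriented surface, given
by its rotation system: `base` attaches the two darts of each edge to the two ends of the edge,
and `rot` sends each dart to the next dart, in the positive sense, around the same vertex. The
cycles of `rot` are exactly the sets of all darts at a common vertex, so `rot` amounts to a cyclic
ordering of the darts at each vertex. -/
structure CellularEmbedding {α : Type u} {β : Type v} (G : Graph α β) where
  /-- the vertex at which a dart is based -/
  base : G.HalfEdge → α
  /-- the two darts of an edge are based at its two ends -/
  isLink_base : ∀ e : ↥G.edgeSet, G.IsLink e.1 (base (e, false)) (base (e, true))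
  /-- the rotation -/
  rot : Equiv.Perm G.HalfEdge
  /-- the rotation permutes the darts at each vertex in a single cycle -/
  sameCycle_rot_iff : ∀ d d' : G.HalfEdge, rot.SameCycle d d' ↔ base d = base d'

/-- The face-tracing permutation: traverse the edge of a dart to its other end, and continue there
with the next dart in the rotation. Its cycles are the boundary walks of the faces. -/
def CellularEmbedding.faceTrace {α : Type u} {β : Type v} {G : Graph α β}
    (R : G.CellularEmbedding) : Equiv.Perm G.HalfEdge :=
  R.rot * G.halfEdgeFlip

/-- The number of faces: the number of cycles (fixed points included) of the face-tracing
permutation. The `max` only matters for a connected graph without edges, that is a single vertex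
on the sphere, whose complement is one face. -/
noncomputable def CellularEmbedding.faceCount {α : Type u} {β : Type v} {G : Graph α β}
    (R : G.CellularEmbedding) : ℕ :=
  max 1 (Nat.card (Quotient (Equiv.Perm.SameCycle.setoid R.faceTrace)))

/-- The surface of the embedding has genus `g`, as given by the Euler-Poincaré equation
`|V| - |E| + r = 2 - 2g`, where `r` is the number of faces. -/
def CellularEmbedding.HasGenus {α : Type u} {β : Type v} {G : Graph α β}
    (R : G.CellularEmbedding) (g : ℤ) : Prop :=
  (G.vertexSet.ncard : ℤ) - (G.edgeSet.ncard : ℤ) + (R.faceCount : ℤ) = 2 - 2 * g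

/-- `g` is the maximum genus of `G`: the largest genus of an orientable surface on which `G` has
a cellular embedding. -/
def IsMaximumGenus {α : Type u} {β : Type v} (G : Graph α β) (g : ℤ) : Prop :=
  IsGreatest {h : ℤ | ∃ R : G.CellularEmbedding, R.HasGenus h} g

/-- A finite connected graph is upper-embeddable if its maximum genus is `⌊β(G) / 2⌋`, where
`β(G)` is the Betti number. (The division of integers rounds down.) -/
def IsUpperEmbeddable {α : Type u} {β : Type v} (G : Graph α β) : Prop :=
  G.IsMaximumGenus (G.bettiNumber / 2)

end Graph

/-! Vertices and faces are treated as cycles of permutations of the darts. If `f` has the vertices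
as cycles and `t` flips every edge, the faces are the cycles of `f * t`. Multiplication by a
transposition merges two cycles or splits one, so every change of the graph or of the embedding is
followed by counting cycles. Splitting a cubic vertex into three vertices of degree 1 adds two
cycles to `f`. The edges form a forest on the cycles of `f` exactly when each edge, as it is
inserted into the flip, merges two cycles (`IsForestOn`).

Lower bound: splitting all vertices of a decycling set `J` leaves a forest, with `n + 2|J| - |E|`
faces. Each vertex can be merged again, in one of its two cyclic orders, without raising this number
(`exists_merge`). The resulting embedding has at least one face, and `2|E| = 3n`, so `|J| ≥ (n +
2)/4`. At equality it has at most two faces, which is upper-embeddability.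

Converse: in a one-face embedding of positive genus, number the darts along the face. There are at
least `|E| + 1` descents of the rotation, and so two at the same vertex. That vertex has degree 3
and can be split with one face kept (`exists_split_cycleCount_eq_one`). Repetition ends in a forest,
and the split vertices form a decycling set. With two faces, detaching one dart at a vertex where
both faces meet first leaves a single face. -/

namespace Equiv.Perm

/-! ### Cycle counts under multiplication by transpositions -/

section CycleCount

variable {D : Type*}

/-- The number of cycles of a permutation, fixed points included. -/
noncomputable def cycleCount (f : Perm D) : ℕ :=
  Nat.card (Quotient (SameCycle.setoid f))

/-- On a finite set every point of a cycle is reached by nonnegative iterates, so no step for the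
inverse is needed. -/
theorem SameCycle.induction_on [Finite D] {f : Perm D} {P : D → Prop} {x y : D}
    (h : f.SameCycle x y) (hx : P x) (hf : ∀ z, P z → P (f z)) : P y := by
  obtain ⟨n, rfl⟩ := h.exists_nat_pow_eq
  induction n with
  | zero => simpa using hx
  | succ n ih =>
    rw [pow_succ', mul_apply]
    exact hf _ (ih ⟨n, by simp⟩)

theorem SameCycle.apply_eq [Finite D] {W : Type*} {f : Perm D} {p : D → W} {x y : D}
    (h : f.SameCycle x y) (hf : ∀ z, p (f z) = p z) : p y = p x :=
  h.induction_on (P := fun z => p z = p x) (Eq.refl _) fun z hz => (hf z).trans hz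

theorem SameCycle.of_forall [Finite D] {f g : Perm D} {x y : D}
    (h : f.SameCycle x y) (hf : ∀ z, g.SameCycle z (f z)) : g.SameCycle x y :=
  h.induction_on (P := fun z => g.SameCycle x z) (SameCycle.refl _ _)
    fun z hz => hz.trans (hf z)

theorem one_le_cycleCount [Finite D] [Nonempty D] (f : Perm D) : 1 ≤ f.cycleCount :=
  have : Nonempty (Quotient (SameCycle.setoid f)) := Nonempty.map (Quotient.mk _) ‹_›
  Nat.card_pos

theorem sameCycle_of_cycleCount_eq_one [Finite D] {f : Perm D} (h : f.cycleCount = 1) (x y : D) :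
    f.SameCycle x y := by
  have := (Nat.card_eq_one_iff_unique.1 h).1
  exact Quotient.exact (s := SameCycle.setoid f) (Subsingleton.elim _ _)

theorem cycleCount_eq_card_range {W : Type*} {f : Perm D} {p : D → W}
    (h : ∀ x y, f.SameCycle x y ↔ p x = p y) : f.cycleCount = (Set.range p).ncard := by
  rw [← Nat.card_coe_set_eq]
  have hs : SameCycle.setoid f = Setoid.ker p := Setoid.ext h
  rw [cycleCount, hs]
  exact Nat.card_congr (Setoid.quotientKerEquivRange p)

theorem not_sameCycle_of_apply_eq_self [Finite D] {f : Perm D} {x y : D} (h : f x = x) (hne : x ≠ y) : ¬ f.SameCycle x y := by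
  intro h'
  exact hne ((h'.induction_on (P := fun z => z = x) rfl
    (by rintro z rfl; exact h))).symm

variable [Finite D] [DecidableEq D] {f : Perm D} {a b x y : D}

/-- The product sends `a` to `f b` and agrees with `f` away from `a` and `b`. From `f b` it
therefore follows the old cycle of `b` until it reaches `b`. -/
theorem sameCycle_mul_swap_self (h : ¬ f.SameCycle a b) : (f * swap a b).SameCycle a b := by
  by_contra hab
  set g := f * swap a b with hg
  have key : g.SameCycle a b ∧ ¬ f.SameCycle a b := by
    have hb : f.SameCycle (f b) b := (sameCycle_apply_left).2 (SameCycle.refl _ _)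
    refine hb.induction_on (P := fun z => g.SameCycle a z ∧ ¬ f.SameCycle a z) ?_ ?_
    · refine ⟨⟨1, by simp [hg]⟩, fun h' => h (h'.trans hb)⟩
    · rintro z ⟨h1, h2⟩
      refine ⟨?_, fun h' => h2 (sameCycle_apply_right.1 h')⟩
      have hza : z ≠ a := by rintro rfl; exact h2 (SameCycle.refl _ _)
      have hzb : z ≠ b := by rintro rfl; exact hab h1
      have : f z = g z := by simp [hg, swap_apply_of_ne_of_ne hza hzb]
      rw [this]
      exact sameCycle_apply_right.2 h1
  exact hab key.1

theorem SameCycle.mul_swap (hxy : f.SameCycle x y) (h : ¬ f.SameCycle a b) :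
    (f * swap a b).SameCycle x y := by
  have hab := sameCycle_mul_swap_self h
  refine hxy.of_forall fun z => ?_
  by_cases hza : z = a
  · subst hza
    refine hab.trans ⟨1, by simp⟩
  by_cases hzb : z = b
  · subst hzb
    refine hab.symm.trans ⟨1, by simp⟩
  · exact ⟨1, by simp [swap_apply_of_ne_of_ne hza hzb]⟩

theorem cycleCount_mul_swap_add_one (h : ¬ f.SameCycle a b) :
    (f * swap a b).cycleCount + 1 = f.cycleCount := by
  classical
  set g := f * swap a b with hg
  let q : D → Quotient (SameCycle.setoid f) := fun x => Quotient.mk _ x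
  have hq : ∀ {x y}, q x = q y ↔ f.SameCycle x y := fun {x y} => Quotient.eq (r := SameCycle.setoid f)
  -- The cycles of the product are the fibres of `m`, which redirects the class of `b` to that of
  -- `a`; its range misses only `q b`.
  let m : D → Quotient (SameCycle.setoid f) := fun x => if q x = q b then q a else q x
  have hab : q a ≠ q b := fun h' => h (hq.1 h')
  have hfq : ∀ x, q (f x) = q x := fun x => hq.2 (sameCycle_apply_left.2 (SameCycle.refl _ _))
  have hm : ∀ x, m (g x) = m x := by
    intro x
    by_cases hxa : x = a
    · subst hxa; simp [m, hg, hfq]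
    by_cases hxb : x = b
    · subst hxb; simp [m, hg, hfq]
    · simp [m, hg, hfq, swap_apply_of_ne_of_ne hxa hxb]
  have hgm : ∀ x y, g.SameCycle x y ↔ m x = m y := by
    intro x y
    refine ⟨fun hxy => (hxy.apply_eq hm).symm, fun hxy => ?_⟩
    have hga := sameCycle_mul_swap_self h
    simp only [m] at hxy
    split_ifs at hxy with h1 h2 h2
    · exact (hq.1 (h1.trans h2.symm)).mul_swap h
    · exact ((hq.1 h1).mul_swap h).trans (hga.symm.trans ((hq.1 hxy).mul_swap h))
    · exact ((hq.1 hxy).mul_swap h).trans (hga.trans ((hq.1 h2).mul_swap h).symm)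
    · exact (hq.1 hxy).mul_swap h
  rw [cycleCount_eq_card_range hgm]
  have hr : Set.range m = {q b}ᶜ := by
    ext z
    constructor
    · rintro ⟨x, rfl⟩
      simp only [m]
      split_ifs with h1
      · exact hab
      · exact h1
    · obtain ⟨x, rfl⟩ := Quotient.exists_rep z
      intro hx
      exact ⟨x, if_neg hx⟩
  rw [hr, ← Set.ncard_singleton (q b), add_comm, Set.ncard_add_ncard_compl]
  rfl

/-- Cut the cycle at the first arrival at `b`: the arc from `f a` to `b` is closed under the
product, which sends `b` to `f a`, and it does not contain `a`. -/
theorem not_sameCycle_mul_swap (h : f.SameCycle a b) (hne : a ≠ b) :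
    ¬ (f * swap a b).SameCycle a b := by
  intro hab
  have hex : ∃ k, (f ^ (k + 1)) a = b := by
    obtain ⟨k, hk⟩ := h.exists_nat_pow_eq
    cases k with
    | zero => exact absurd hk hne
    | succ k => exact ⟨k, hk⟩
  classical
  let k := Nat.find hex
  have hk : (f ^ (k + 1)) a = b := Nat.find_spec hex
  have hmin : ∀ i < k, (f ^ (i + 1)) a ≠ b := fun i hi => Nat.find_min hex hi
  have hret : ∀ i ≤ k, (f ^ (i + 1)) a ≠ a := by
    intro i hi hia
    rcases hi.eq_or_lt with rfl | hi
    · exact hne (hia.symm.trans hk)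
    · obtain ⟨j, hj⟩ := Nat.exists_eq_add_of_lt hi
      refine hmin j (by omega) ?_
      rw [← hk, hj, show i + j + 1 + 1 = (j + 1) + (i + 1) by omega, pow_add f (j + 1) (i + 1),
        mul_apply, hia]
  have := hab.symm.induction_on (P := fun z => ∃ i ≤ k, (f ^ (i + 1)) a = z) ⟨k, le_rfl, hk⟩ ?_
  · obtain ⟨i, hi, hia⟩ := this
    exact hret i hi hia
  · rintro z ⟨i, hi, rfl⟩
    rcases hi.eq_or_lt with rfl | hi
    · rw [hk]
      exact ⟨0, Nat.zero_le _, by simp⟩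
    · refine ⟨i + 1, hi, ?_⟩
      rw [mul_apply, swap_apply_of_ne_of_ne (hret i hi.le) (hmin i hi), pow_succ' f (i + 1),
        mul_apply]

theorem cycleCount_mul_swap (h : f.SameCycle a b) (hne : a ≠ b) :
    (f * swap a b).cycleCount = f.cycleCount + 1 := by
  have := cycleCount_mul_swap_add_one (not_sameCycle_mul_swap h hne)
  rw [mul_assoc, swap_mul_self, mul_one] at this
  exact this.symm

theorem sameCycle_swap_mul_self (h : ¬ f.SameCycle x y) : (swap x y * f).SameCycle x y := by
  have h' : ¬ f.SameCycle (f⁻¹ x) (f⁻¹ y) := by simpa using h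
  have := sameCycle_mul_swap_self h'
  rw [← swap_mul_eq_mul_swap] at this
  rw [← sameCycle_apply_left, ← sameCycle_apply_right] at this
  simpa using this.symm

theorem SameCycle.swap_mul {u v : D} (huv : f.SameCycle u v) (h : ¬ f.SameCycle x y) :
    (swap x y * f).SameCycle u v := by
  rw [swap_mul_eq_mul_swap]
  exact huv.mul_swap (by simpa using h)

theorem cycleCount_swap_mul_add_one (h : ¬ f.SameCycle x y) :
    (swap x y * f).cycleCount + 1 = f.cycleCount := by
  rw [swap_mul_eq_mul_swap]
  exact cycleCount_mul_swap_add_one (by simpa using h)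

theorem cycleCount_swap_mul (h : f.SameCycle x y) (hne : x ≠ y) :
    (swap x y * f).cycleCount = f.cycleCount + 1 := by
  rw [swap_mul_eq_mul_swap]
  exact cycleCount_mul_swap (by simpa using h) (by simpa using hne)

theorem not_sameCycle_swap_mul (h : f.SameCycle x y) (hne : x ≠ y) :
    ¬ (swap x y * f).SameCycle x y := by
  intro hc
  have h1 := cycleCount_swap_mul hc hne
  have h2 := cycleCount_swap_mul h hne
  rw [← mul_assoc, swap_mul_self, one_mul] at h1
  omega

theorem cycleCount_swap_mul_le (f : Perm D) (hne : x ≠ y) :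
    (swap x y * f).cycleCount ≤ f.cycleCount + 1 := by
  by_cases h : f.SameCycle x y
  · exact (cycleCount_swap_mul h hne).le
  · have := cycleCount_swap_mul_add_one h
    omega

/-- One of the two cyclic orders on three points can be inserted in a permutation without an
increase of the number of cycles. -/
theorem exists_threeCycle_mul_cycleCount_le (f : Perm D) {x y z : D} (hxy : x ≠ y)
    (hxz : x ≠ z) :
    (swap x z * (swap x y * f)).cycleCount ≤ f.cycleCount ∨
      (swap y z * (swap y x * f)).cycleCount ≤ f.cycleCount := by
  rw [swap_comm y x]
  -- If `x` and `y` share a cycle, the first transposition separates them, and `z` then misses the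
  -- cycle of at least one of them; joining `z` to that one makes up for the split. Otherwise the
  -- first transposition already merges.
  by_cases h : f.SameCycle x y
  · have h1 := cycleCount_swap_mul h hxy
    by_cases hz : (swap x y * f).SameCycle x z
    · right
      have : ¬ (swap x y * f).SameCycle y z := fun h' =>
        not_sameCycle_swap_mul h hxy (hz.trans h'.symm)
      have := cycleCount_swap_mul_add_one this
      omega
    · left
      have := cycleCount_swap_mul_add_one hz
      omega
  · left
    have h1 := cycleCount_swap_mul_add_one h
    have h2 := cycleCount_swap_mul_le (swap x y * f) hxz
    omega

/-- Joining three fixed points to a cycle. -/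
theorem cycleCount_threeCycle_mul {z : D} (hxy : x ≠ y) (hxz : x ≠ z) (hyz : y ≠ z)
    (hx : f x = x) (hz : f z = z) :
    (swap x z * (swap x y * f)).cycleCount + 2 = f.cycleCount ∧
    (∀ u v, f.SameCycle u v → (swap x z * (swap x y * f)).SameCycle u v) ∧
    (swap x z * (swap x y * f)).SameCycle x y ∧ (swap x z * (swap x y * f)).SameCycle x z := by
  have h1 := not_sameCycle_of_apply_eq_self hx hxy
  have hz' : (swap x y * f) z = z := by
    rw [mul_apply, hz, swap_apply_of_ne_of_ne hxz.symm hyz.symm]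
  have h2 : ¬ (swap x y * f).SameCycle x z := fun h =>
    not_sameCycle_of_apply_eq_self hz' hxz.symm h.symm
  have e1 := cycleCount_swap_mul_add_one h1
  have e2 := cycleCount_swap_mul_add_one h2
  exact ⟨by omega, fun u v huv => (huv.swap_mul h1).swap_mul h2,
    (sameCycle_swap_mul_self h1).swap_mul h2, sameCycle_swap_mul_self h2⟩

end CycleCount

/-- Every partition is the partition into the cycles of some permutation. -/
theorem exists_sameCycle_iff {D W : Type*} [Finite D] (p : D → W) :
    ∃ f : Perm D, ∀ x y, f.SameCycle x y ↔ p x = p y := by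
  classical
  -- Take a permutation with the fewest cycles among those that preserve the fibres of `p`. Two
  -- cycles in one fibre could still be merged by a transposition.
  have hne : ∃ k, ∃ f : Perm D, (∀ x, p (f x) = p x) ∧ f.cycleCount = k :=
    ⟨_, 1, fun _ => rfl, rfl⟩
  obtain ⟨f, hf, hk⟩ := Nat.find_spec hne
  refine ⟨f, fun x y => ⟨fun h => (h.apply_eq hf).symm, fun hxy => ?_⟩⟩
  by_contra h
  have hc := cycleCount_mul_swap_add_one h
  refine Nat.find_min hne (m := (f * swap x y).cycleCount) (by omega) ⟨_, fun z => ?_, rfl⟩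
  rw [mul_apply, hf, swap_apply_def]
  split_ifs with h1 h2
  · rw [h1, hxy]
  · rw [h2, hxy]
  · rfl

/-! ### Inserting edges one by one, and forests -/

section Flip

variable {E : Type*} [DecidableEq E]

/-- The involution that interchanges the two darts of every edge in `S`. -/
def flipOn (S : Finset E) : Perm (E × Bool) :=
  Function.Involutive.toPerm (fun d => if d.1 ∈ S then (d.1, !d.2) else d) (by
    intro d
    by_cases h : d.1 ∈ S <;> simp [h])

theorem flipOn_apply_of_mem {S : Finset E} {d : E × Bool} (h : d.1 ∈ S) :
    flipOn S d = (d.1, !d.2) := if_pos h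

theorem flipOn_apply_of_notMem {S : Finset E} {d : E × Bool} (h : d.1 ∉ S) :
    flipOn S d = d := if_neg h

theorem flipOn_empty : flipOn (∅ : Finset E) = 1 := rfl

theorem flipOn_insert {S : Finset E} {e : E} (h : e ∉ S) :
    flipOn (insert e S) = flipOn S * swap (e, false) (e, true) := by
  ext1 d
  rw [mul_apply]
  by_cases hd : d.1 = e
  · obtain ⟨e', b⟩ := d
    obtain rfl : e' = e := hd
    rw [flipOn_apply_of_mem (by simp)]
    cases b
    · rw [swap_apply_left, flipOn_apply_of_notMem (by simpa using h)]; rfl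
    · rw [swap_apply_right, flipOn_apply_of_notMem (by simpa using h)]; rfl
  · rw [swap_apply_of_ne_of_ne (by rintro rfl; exact hd rfl) (by rintro rfl; exact hd rfl)]
    by_cases hS : d.1 ∈ S
    · rw [flipOn_apply_of_mem hS, flipOn_apply_of_mem (by simp [hS])]
    · rw [flipOn_apply_of_notMem hS, flipOn_apply_of_notMem (by simp [hS, hd])]

variable (f : Perm (E × Bool))

/-- The edges in `S` join the cycles of `f` like the edges of a forest. -/
def IsForestOn (S : Finset E) : Prop :=
  (f * flipOn S).cycleCount + S.card = f.cycleCount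

theorem isForestOn_empty : f.IsForestOn ∅ := by simp [IsForestOn, flipOn_empty]

variable [Finite E]

theorem cycleCount_mul_flipOn_insert {S : Finset E} {e : E} (h : e ∉ S) :
    (f * flipOn S).SameCycle (e, false) (e, true) ∧
      (f * flipOn (insert e S)).cycleCount = (f * flipOn S).cycleCount + 1 ∨
    ¬ (f * flipOn S).SameCycle (e, false) (e, true) ∧
      (f * flipOn (insert e S)).cycleCount + 1 = (f * flipOn S).cycleCount := by
  rw [flipOn_insert h, ← mul_assoc]
  by_cases hs : (f * flipOn S).SameCycle (e, false) (e, true)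
  · exact Or.inl ⟨hs, cycleCount_mul_swap hs (by simp)⟩
  · exact Or.inr ⟨hs, cycleCount_mul_swap_add_one hs⟩

theorem cycleCount_mul_flipOn_le_union (S T : Finset E) (h : _root_.Disjoint S T) :
    (f * flipOn S).cycleCount ≤ (f * flipOn (T ∪ S)).cycleCount + T.card := by
  induction T using Finset.induction_on with
  | empty => simp
  | insert e T he ih =>
    rw [Finset.disjoint_insert_right] at h
    have := ih h.2
    rw [Finset.insert_union, Finset.card_insert_of_notMem he]
    rcases cycleCount_mul_flipOn_insert f (S := T ∪ S) (e := e) (by simp [he, h.1]) with h' | h' <;>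
      omega

theorem cycleCount_le_mul_flipOn (S : Finset E) :
    f.cycleCount ≤ (f * flipOn S).cycleCount + S.card := by
  simpa [flipOn_empty] using cycleCount_mul_flipOn_le_union f ∅ S (by simp)

theorem cycleCount_mul_flipOn_parity (S : Finset E) :
    (f * flipOn S).cycleCount % 2 = (f.cycleCount + S.card) % 2 := by
  induction S using Finset.induction_on with
  | empty => simp [flipOn_empty]
  | insert e S he ih =>
    rw [Finset.card_insert_of_notMem he]
    rcases cycleCount_mul_flipOn_insert f he with h' | h' <;> omega

variable {f}

/-- Each edge lowers the count by at most one, so the total drop `|T|` forces every subset to attain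
its own maximal drop. -/
theorem IsForestOn.mono {S T : Finset E} (hT : f.IsForestOn T) (h : S ⊆ T) : f.IsForestOn S := by
  have h1 := cycleCount_mul_flipOn_le_union f S (T \ S) Finset.disjoint_sdiff
  rw [Finset.sdiff_union_of_subset h, Finset.card_sdiff_of_subset h] at h1
  have h2 := cycleCount_le_mul_flipOn f S
  have h3 := Finset.card_le_card h
  unfold IsForestOn at *
  omega

theorem IsForestOn.insert_iff {S : Finset E} (hS : f.IsForestOn S) {e : E} (he : e ∉ S) :
    f.IsForestOn (insert e S) ↔ ¬ (f * flipOn S).SameCycle (e, false) (e, true) := by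
  unfold IsForestOn at *
  rw [Finset.card_insert_of_notMem he]
  rcases cycleCount_mul_flipOn_insert f he with ⟨h, h'⟩ | ⟨h, h'⟩
  · simp only [h, not_true_eq_false, iff_false]; omega
  · simp only [h, not_false_eq_true, iff_true]; omega

/-- While only merges occur, the cycles of `f * flipOn S` are the components: they contain whole
vertices and both darts of each inserted edge. -/
theorem IsForestOn.sameCycle {S : Finset E} (hS : f.IsForestOn S) :
    (∀ x y, f.SameCycle x y → (f * flipOn S).SameCycle x y) ∧
      ∀ e ∈ S, (f * flipOn S).SameCycle (e, false) (e, true) := by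
  induction S using Finset.induction_on with
  | empty => simp [flipOn_empty]
  | insert e S he ih =>
    have hS' := hS.mono (Finset.subset_insert e S)
    have h := (hS'.insert_iff he).1 hS
    obtain ⟨h1, h2⟩ := ih hS'
    rw [flipOn_insert he, ← mul_assoc]
    refine ⟨fun x y hxy => (h1 x y hxy).mul_swap h, fun e' he' => ?_⟩
    rcases Finset.mem_insert.1 he' with rfl | he'
    · exact sameCycle_mul_swap_self h
    · exact (h2 e' he').mul_swap h

end Flip

end Equiv.Perm

/-! ### One-face embeddings: numbering the darts and splitting a vertex -/

namespace Equiv.Perm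

/-- The numbering of the points of a permutation with a single cycle along this cycle. -/
theorem exists_label {D : Type*} [Finite D] {f : Perm D} (hf : ∀ x y, f.SameCycle x y) (o : D) :
    ∃ l : D → ℕ, Function.Injective l ∧ l o = 0 ∧ (∀ d, f d ≠ o → l (f d) = l d + 1) ∧
      ∀ d d', f d = o → l d' ≤ l d := by
  classical
  have hex : ∀ d, ∃ k, (f ^ k) o = d := fun d => (hf o d).exists_nat_pow_eq
  let l : D → ℕ := fun d => Nat.find (hex d)
  have hl : ∀ d, (f ^ l d) o = d := fun d => Nat.find_spec (hex d)
  have hmin : ∀ d k, (f ^ k) o = d → l d ≤ k := fun d k => Nat.find_min' (hex d)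
  refine ⟨l, fun x y hxy => by rw [← hl x, ← hl y, hxy], Nat.le_zero.1 (hmin o 0 rfl), ?_, ?_⟩
  · intro d hd
    apply le_antisymm
    · apply hmin
      rw [pow_succ', mul_apply, hl]
    · have h1 := hl (f d)
      cases hk : l (f d) with
      | zero =>
        rw [hk] at h1
        exact absurd h1.symm hd
      | succ k =>
        rw [hk, pow_succ', mul_apply] at h1
        have := hmin d k (f.injective h1)
        omega
  · intro d d' hd
    by_contra! hlt
    obtain ⟨j, hj⟩ := Nat.exists_eq_add_of_lt hlt
    have h1 := hl d'
    rw [hj, show l d + j + 1 = j + (l d + 1) by omega, pow_add, mul_apply, pow_succ' f (l d),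
      mul_apply, hl, hd] at h1
    have := hmin d' j h1
    omega

/-- Two points on different arcs of a cycle are separated by the exchange of the ends
of the arcs. -/
theorem not_sameCycle_swap_mul_of_label {D : Type*} [Finite D] [DecidableEq D] {f : Perm D} {o : D}
    {l : D → ℕ} (hinj : Function.Injective l) (hsucc : ∀ d, f d ≠ o → l (f d) = l d + 1)
    (hlast : ∀ d d', f d = o → l d' ≤ l d) {p q u w : D} (hpu : l p ≤ l u) (huq : l u < l q)
    (hw : l q ≤ l w) : ¬ (swap p q * f).SameCycle u w := by
  intro h
  -- The labels from `l p` up to, but excluding, `l q` form an invariant arc: where `f` would leave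
  -- it at `q`, the exchange returns to `p`.
  have := h.induction_on (P := fun d => l p ≤ l d ∧ l d < l q) ⟨hpu, huq⟩ ?_
  · omega
  · rintro d ⟨h1, h2⟩
    have ho : f d ≠ o := fun ho => absurd (hlast d q ho) (by omega)
    have h3 := hsucc d ho
    rw [mul_apply]
    by_cases hq : f d = q
    · rw [hq, swap_apply_right]
      exact ⟨le_rfl, hpu.trans_lt huq⟩
    · have hp : f d ≠ p := by
        intro hp
        rw [hp] at h3
        omega
      have : l (f d) ≠ l q := fun h => hq (hinj h)
      rw [swap_apply_of_ne_of_ne hp hq]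
      omega

section

variable {E : Type*} [Fintype E] [DecidableEq E]

theorem flipOn_univ_apply (d : E × Bool) : flipOn Finset.univ d = (d.1, !d.2) :=
  flipOn_apply_of_mem (Finset.mem_univ _)

theorem flipOn_univ_flipOn_univ (d : E × Bool) :
    flipOn Finset.univ (flipOn Finset.univ d) = d := by
  simp [flipOn_univ_apply]

/-- In an embedding with a single face and fewer than `|E| + 1` vertices there are two descents
at a common vertex. -/
theorem exists_two_descents {f : Perm (E × Bool)} {l : E × Bool → ℕ} {o : E × Bool}
    (hinj : Function.Injective l) (hzero : l o = 0)
    (hsucc : ∀ d, (f * flipOn Finset.univ : Perm (E × Bool)) d ≠ o →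
      l ((f * flipOn Finset.univ : Perm (E × Bool)) d) = l d + 1)
    (hlast : ∀ d d', (f * flipOn Finset.univ : Perm (E × Bool)) d = o → l d' ≤ l d)
    (hc : f.cycleCount ≤ Fintype.card E) :
    ∃ d d', d ≠ d' ∧ f.SameCycle d d' ∧ l (f d) ≤ l d ∧ l (f d') ≤ l d' := by
  set t : Perm (E × Bool) := flipOn Finset.univ with ht
  have htt : ∀ d, t (t d) = d := flipOn_univ_flipOn_univ
  -- The dart `f d` follows `t d` on the face. If `t d` precedes `d`, then `f d` has label at most
  -- `l d`, or it is the start `o`.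
  have hdesc : ∀ d, l (t d) < l d → l (f d) ≤ l d := by
    intro d hd
    have hfd : (f * t) (t d) = f d := by rw [mul_apply, htt]
    by_cases h : f d = o
    · rw [h, hzero]
      exact Nat.zero_le _
    · have := hsucc (t d) (by rwa [hfd])
      rw [hfd] at this
      omega
  obtain ⟨z, hz⟩ := (f * t).surjective o
  -- Each edge gives one descent, at its later dart. The extra one, `t z`, lies before the return to
  -- `o`; it differs from the others because its partner `z` has the largest label.
  let s : Option E → E × Bool
    | none => t z
    | some e => if l (e, false) < l (e, true) then (e, true) else (e, false)
  have hs1 : ∀ e, l (t (s (some e))) < l (s (some e)) := by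
    intro e
    have hne : l (e, false) ≠ l (e, true) := fun h => by simpa using hinj h
    by_cases h : l (e, false) < l (e, true)
    · simp [s, h, ht, flipOn_univ_apply]
    · simp only [s, h, if_false, ht, flipOn_univ_apply, Bool.not_false]
      omega
  have hs2 : ∀ i, l (f (s i)) ≤ l (s i) := by
    rintro (_ | e)
    · change l ((f * t) z) ≤ _
      rw [hz, hzero]
      exact Nat.zero_le _
    · exact hdesc _ (hs1 e)
  have hs3 : ∀ e, (s (some e)).1 = e := by
    intro e
    simp only [s]
    split_ifs <;> rfl
  have hs4 : ∀ e, s none ≠ s (some e) := by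
    intro e h
    have := hs1 e
    rw [← h] at this
    change l (t (t z)) < l (t z) at this
    rw [htt] at this
    exact absurd (hlast z (t z) hz) (by omega)
  have hsinj : Function.Injective s := by
    rintro (_ | e) (_ | e') h
    · rfl
    · exact absurd h (hs4 e')
    · exact absurd h.symm (hs4 e)
    · rw [← hs3 e, ← hs3 e', h]
  -- Pigeonhole: `|E| + 1` descents on at most `|E|` cycles of `f`.
  have hnot : ¬ Function.Injective
      (fun i => (Quotient.mk (SameCycle.setoid f) (s i))) := by
    intro h
    have := Nat.card_le_card_of_injective _ h
    rw [Finite.card_option, Nat.card_eq_fintype_card] at this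
    unfold cycleCount at hc
    omega
  simp only [Function.Injective, not_forall] at hnot
  obtain ⟨i, j, hij, hne⟩ := hnot
  exact ⟨s i, s j, fun h => hne (hsinj h), Quotient.exact (s := SameCycle.setoid f) hij,
    hs2 i, hs2 j⟩

/-- In an embedding with a single face, degrees at most `3` and positive genus, some vertex of
degree `3` can be split into three vertices of degree `1` such that there remains
a single face. -/
theorem exists_split_cycleCount_eq_one [Nonempty E] {f : Perm (E × Bool)}
    (h1 : (f * flipOn Finset.univ).cycleCount = 1) (hc : f.cycleCount ≤ Fintype.card E)
    (hf : ∀ d, f (f d) = d ∨ f (f (f d)) = d) :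
    ∃ d, f (f (f d)) = d ∧ f d ≠ d ∧ f (f d) ≠ d ∧
      ((swap d (f d) * (swap d (f (f d)) * f)) * flipOn Finset.univ).cycleCount = 1 := by
  let o : E × Bool := (Classical.arbitrary E, true)
  obtain ⟨l, hinj, hzero, hsucc, hlast⟩ :=
    exists_label (fun x y => sameCycle_of_cycleCount_eq_one h1 x y) o
  have main : ∀ d, f (f (f d)) = d → f (f d) ≠ d → l (f d) ≤ l d → l (f (f d)) ≤ l (f d) →
      ∃ d, f (f (f d)) = d ∧ f d ≠ d ∧ f (f d) ≠ d ∧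
      ((swap d (f d) * (swap d (f (f d)) * f)) * flipOn Finset.univ).cycleCount = 1 := by
    intro d h3 h2 hl1 hl2
    have hd : f d ≠ d := fun h => h2 (by rw [h, h])
    have hd' : f (f d) ≠ f d := fun h => hd (f.injective h)
    have n1 : l (f d) ≠ l d := fun h => hd (hinj h)
    have n2 : l (f (f d)) ≠ l (f d) := fun h => hd' (hinj h)
    refine ⟨d, h3, hd, h2, ?_⟩
    -- With labels decreasing along `d`, `f d`, `f (f d)`, the first exchange splits the face with
    -- `f d` and `d` on different parts, and the second joins these again.
    have hsep := not_sameCycle_swap_mul_of_label hinj hsucc hlast (p := f (f d)) (q := d)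
      (u := f d) (w := d) hl2 (by omega) le_rfl
    rw [swap_comm (f (f d)) d] at hsep
    have e1 := cycleCount_swap_mul (sameCycle_of_cycleCount_eq_one h1 d (f (f d))) h2.symm
    have e2 := cycleCount_swap_mul_add_one fun h => hsep h.symm
    rw [mul_assoc, mul_assoc]
    omega
  obtain ⟨d, d', hne, hs, hd, hd'⟩ := exists_two_descents hinj hzero hsucc hlast hc
  -- A cycle of length at most 2 cannot carry two distinct descents: the labels would be equal.
  by_cases h2 : f (f d) = d
  · have : d' = d ∨ d' = f d := by
      refine hs.induction_on (P := fun z => z = d ∨ z = f d) (Or.inl (Eq.refl _)) ?_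
      rintro z (rfl | rfl)
      · exact Or.inr rfl
      · exact Or.inl h2
    rcases this with rfl | rfl
    · exact absurd rfl hne
    · rw [h2] at hd'
      exact absurd (hinj (le_antisymm hd' hd)) hne
  · have h3 := (hf d).resolve_left h2
    have : d' = d ∨ d' = f d ∨ d' = f (f d) := by
      refine hs.induction_on (P := fun z => z = d ∨ z = f d ∨ z = f (f d)) (Or.inl (Eq.refl _)) ?_
      rintro z (rfl | rfl | rfl)
      · exact Or.inr (Or.inl rfl)
      · exact Or.inr (Or.inr rfl)
      · exact Or.inl h3
    rcases this with rfl | rfl | rfl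
    · exact absurd rfl hne
    · exact main d h3 h2 hd hd'
    · refine main (f (f d)) (by rw [h3]) (fun h => ?_) hd' (by rw [h3]; exact hd)
      exact h2 (f.injective (f.injective h))

end

end Equiv.Perm

/-! ### Darts, degrees and the handshake lemma -/

namespace Graph

open Equiv Equiv.Perm

section

variable {α : Type*} {β : Type*} {G : Graph α β} {b : G.HalfEdge → α}

theorem base_mem (hb : ∀ e : ↥G.edgeSet, G.IsLink e.1 (b (e, false)) (b (e, true)))
    (d : G.HalfEdge) : b d ∈ G.vertexSet := by
  obtain ⟨e, _ | _⟩ := d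
  exacts [(hb e).left_mem, (hb e).right_mem]

theorem isLink_base_not (hb : ∀ e : ↥G.edgeSet, G.IsLink e.1 (b (e, false)) (b (e, true)))
    (d : G.HalfEdge) : G.IsLink d.1.1 (b d) (b (d.1, !d.2)) := by
  obtain ⟨e, _ | _⟩ := d
  exacts [hb e, (hb e).symm]

theorem exists_base_eq (hb : ∀ e : ↥G.edgeSet, G.IsLink e.1 (b (e, false)) (b (e, true)))
    {e : β} {x y : α} (h : G.IsLink e x y) :
    ∃ d : G.HalfEdge, d.1.1 = e ∧ b d = x ∧ b (d.1, !d.2) = y := by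
  rcases h.eq_and_eq_or_eq_and_eq (hb ⟨e, h.edge_mem⟩) with ⟨h1, h2⟩ | ⟨h1, h2⟩
  · exact ⟨(⟨e, h.edge_mem⟩, false), rfl, h1.symm, h2.symm⟩
  · exact ⟨(⟨e, h.edge_mem⟩, true), rfl, h1.symm, h2.symm⟩

/-- The degree of a vertex is the number of darts based at it. -/
theorem encard_setOf_base_eq (hb : ∀ e : ↥G.edgeSet, G.IsLink e.1 (b (e, false)) (b (e, true)))
    (x : α) : {d : G.HalfEdge | b d = x}.encard = G.vertexDegree x := by
  set A : Set ↥G.edgeSet := {e | b (e, false) = x} with hA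
  set B : Set ↥G.edgeSet := {e | b (e, true) = x} with hB
  have h1 : {d : G.HalfEdge | b d = x} = (fun e => (e, false)) '' A ∪ (fun e => (e, true)) '' B := by
    ext ⟨e, _ | _⟩ <;> simp [hA, hB]
  have h2 : G.incidenceSet x = Subtype.val '' (A ∪ B) := by
    ext e
    constructor
    · rintro ⟨y, h⟩
      refine ⟨⟨e, h.edge_mem⟩, ?_, rfl⟩
      rcases h.eq_and_eq_or_eq_and_eq (hb ⟨e, h.edge_mem⟩) with ⟨h1, h2⟩ | ⟨h1, h2⟩
      exacts [Or.inl h1.symm, Or.inr h1.symm]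
    · rintro ⟨e, h | h, rfl⟩
      · exact ⟨_, (show b (e, false) = x from h) ▸ hb e⟩
      · exact ⟨_, (show b (e, true) = x from h) ▸ (hb e).symm⟩
  have h3 : G.loopSet x = Subtype.val '' (A ∩ B) := by
    ext e
    constructor
    · intro h
      have h : G.IsLink e x x := h
      refine ⟨⟨e, h.edge_mem⟩, ?_, rfl⟩
      rcases h.eq_and_eq_or_eq_and_eq (hb ⟨e, h.edge_mem⟩) with ⟨h1, h2⟩ | ⟨h1, h2⟩
      exacts [⟨h1.symm, h2.symm⟩, ⟨h2.symm, h1.symm⟩]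
    · rintro ⟨e, ⟨h, h'⟩, rfl⟩
      have := hb e
      rw [show b (e, false) = x from h, show b (e, true) = x from h'] at this
      exact this
  -- `A` and `B` are the edges whose first or second dart is at `x`; incident edges form the union
  -- and loops the intersection, so the degree is `|A| + |B|`.
  rw [vertexDegree, h2, h3, Subtype.val_injective.encard_image, Subtype.val_injective.encard_image,
    Set.encard_union_add_encard_inter, h1, Set.encard_union_eq,
    (Prod.mk_left_injective _).encard_image, (Prod.mk_left_injective _).encard_image]
  rw [Set.disjoint_left]
  rintro _ ⟨e, -, rfl⟩ ⟨e', -, h⟩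
  simp at h

theorem ncard_setOf_base_eq (hb : ∀ e : ↥G.edgeSet, G.IsLink e.1 (b (e, false)) (b (e, true)))
    (hcubic : G.IsCubic) {x : α} (hx : x ∈ G.vertexSet) : {d : G.HalfEdge | b d = x}.ncard = 3 := by
  rw [Set.ncard_def, encard_setOf_base_eq hb, hcubic x hx]
  rfl

theorem range_base (hb : ∀ e : ↥G.edgeSet, G.IsLink e.1 (b (e, false)) (b (e, true)))
    (hcubic : G.IsCubic) : Set.range b = G.vertexSet := by
  apply Set.Subset.antisymm
  · rintro _ ⟨d, rfl⟩
    exact base_mem hb d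
  · intro x hx
    have : {d : G.HalfEdge | b d = x}.Nonempty := by
      apply Set.nonempty_of_ncard_ne_zero
      rw [ncard_setOf_base_eq hb hcubic hx]
      decide
    exact this

theorem exists_base (G : Graph α β) :
    ∃ b : G.HalfEdge → α, ∀ e : ↥G.edgeSet, G.IsLink e.1 (b (e, false)) (b (e, true)) := by
  have h : ∀ e : ↥G.edgeSet, ∃ x y, G.IsLink e.1 x y := fun e =>
    exists_isLink_of_mem_edgeSet e.2
  choose s t hst using h
  exact ⟨fun d => if d.2 then t d.1 else s d.1, hst⟩

/-- The handshake lemma for cubic graphs. -/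
theorem IsCubic.two_mul_ncard_edgeSet (hcubic : G.IsCubic) (hV : G.vertexSet.Finite)
    (hE : G.edgeSet.Finite) : 2 * G.edgeSet.ncard = 3 * G.vertexSet.ncard := by
  classical
  obtain ⟨b, hb⟩ := exists_base G
  have : Fintype ↥G.edgeSet := hE.fintype
  have h1 := Finset.card_eq_sum_card_fiberwise (f := b) (s := Finset.univ) (t := hV.toFinset)
    (fun d _ => by simpa using base_mem hb d)
  rw [Finset.sum_congr rfl (g := fun _ => 3), Finset.sum_const, smul_eq_mul,
    ← Set.ncard_eq_toFinset_card _ hV, Finset.card_univ, Fintype.card_prod, Fintype.card_bool,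
    ← Nat.card_eq_fintype_card, Nat.card_coe_set_eq] at h1
  · omega
  · intro x hx
    rw [← ncard_setOf_base_eq hb hcubic ((hV.mem_toFinset).1 hx), ← Set.ncard_coe_finset]
    simp

/-! ### Acyclic graphs and forests of cycles -/

section Forest

variable [Fintype ↥G.edgeSet] [DecidableEq ↥G.edgeSet]

/-- If the edges join the cycles of `f` like a forest, then there is no cycle through vertices
whose darts form a cycle of `f`. -/
theorem not_hasCycle_deleteVerts
    (hb : ∀ e : ↥G.edgeSet, G.IsLink e.1 (b (e, false)) (b (e, true)))
    {f : Perm G.HalfEdge} (hF : f.IsForestOn Finset.univ) {J : Set α}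
    (hJ : ∀ d d', b d = b d' → b d ∉ J → f.SameCycle d d') : ¬ (G.deleteVerts J).HasCycle := by
  rintro ⟨k, hk, x, e, hx, he, hlink⟩
  obtain ⟨m, rfl⟩ := Nat.exists_eq_succ_of_ne_zero hk.ne
  have hl : ∀ i, G.IsLink (e i) (x i) (x (i + 1)) ∧ x i ∉ J := fun i => by
    have := hlink i
    rw [deleteVerts_isLink] at this
    exact ⟨this.1, this.2.1⟩
  choose out ho1 ho2 ho3 using fun i => exists_base_eq hb (hl i).1
  -- All edges of the cycle but the last. They already connect the ends of the last edge, which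
  -- therefore could not merge two cycles.
  let S : Finset ↥G.edgeSet := (Finset.univ.erase (Fin.last m)).image fun i => (out i).1
  have hnot : (out (Fin.last m)).1 ∉ S := by
    simp only [S, Finset.mem_image, Finset.mem_erase, Finset.mem_univ, and_true, not_exists,
      not_and]
    intro i hi h
    refine hi (he ?_)
    rw [← ho1, ← ho1, h]
  have hS : f.IsForestOn S := hF.mono (Finset.subset_univ _)
  have h1 := (hS.insert_iff hnot).1 (hF.mono (Finset.subset_univ _))
  obtain ⟨h2, h3⟩ := hS.sameCycle
  have hflip : ∀ d : G.HalfEdge,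
      (f * flipOn S).SameCycle (d.1, false) (d.1, true) ↔
        (f * flipOn S).SameCycle d (d.1, !d.2) := by
    rintro ⟨d, _ | _⟩
    exacts [Iff.rfl, sameCycle_comm]
  have hnext : ∀ i, (f * flipOn S).SameCycle ((out i).1, !(out i).2) (out (i + 1)) := fun i =>
    h2 _ _ (hJ _ _ (by rw [ho3, ho2]) (by rw [ho3]; exact (hl (i + 1)).2))
  have hall : ∀ i : Fin (m + 1), (f * flipOn S).SameCycle (out 0) (out i) := by
    intro i
    induction i using Fin.induction with
    | zero => exact SameCycle.refl _ _
    | succ i ih =>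
      rw [← Fin.coeSucc_eq_succ]
      refine (ih.trans ((hflip _).1 (h3 _ ?_))).trans (hnext _)
      exact Finset.mem_image.2 ⟨i.castSucc, by simp [Fin.castSucc_ne_last], rfl⟩
  have hlast := hnext (Fin.last m)
  rw [Fin.last_add_one] at hlast
  exact h1 ((hflip _).2 (hlast.trans (hall _)).symm)

/-- An edge whose ends are joined by a path of other edges lies on a cycle. -/
theorem hasCycle_of_reachable {H : Graph α β} {S : Set β} {e : β} (he : e ∉ S) {u v : α}
    (huv : H.IsLink e u v)
    (h : (SimpleGraph.fromRel fun x y => ∃ e' ∈ S, H.IsLink e' x y).Reachable u v) :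
    H.HasCycle := by
  obtain ⟨p, hp⟩ := h.exists_isPath
  have hadj : ∀ i, i < p.length → ∃ e' ∈ S, H.IsLink e' (p.getVert i) (p.getVert (i + 1)) := by
    intro i hi
    have := p.adj_getVert_succ hi
    rw [SimpleGraph.fromRel_adj] at this
    rcases this.2 with h | ⟨e', h1, h2⟩
    exacts [h, ⟨e', h1, h2.symm⟩]
  choose c hcS hc using hadj
  have hinj : ∀ i j, i ≤ p.length → j ≤ p.length → p.getVert i = p.getVert j → i = j :=
    fun i j hi hj => hp.getVert_injOn hi hj
  -- The closing edge `e` takes the last index, `p.length`; if `u = v` the path is trivial and `e`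
  -- is a loop.
  refine ⟨p.length + 1, inferInstance, fun i => p.getVert i,
    fun i => if h : i.1 < p.length then c i h else e, ?_, ?_, ?_⟩
  · intro i j hij
    exact Fin.ext (hinj i j (Nat.lt_succ_iff.1 i.2) (Nat.lt_succ_iff.1 j.2) hij)
  · intro i j hij
    have hi := i.2
    have hj := j.2
    apply Fin.ext
    by_cases h1 : i.1 < p.length <;> by_cases h2 : j.1 < p.length <;>
      simp only [h1, h2, dif_pos, dif_neg, not_false_eq_true] at hij
    · have := hc j h2
      rw [← hij] at this
      rcases (hc i h1).eq_and_eq_or_eq_and_eq this with ⟨h3, h4⟩ | ⟨h3, h4⟩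
      · exact hinj _ _ (by omega) (by omega) h3
      · have := hinj _ _ (by omega) (by omega) h3
        have := hinj _ _ (by omega) (by omega) h4
        omega
    · exact absurd (hij ▸ hcS i h1) he
    · exact absurd (hij ▸ hcS j h2) he
    · omega
  · intro i
    by_cases h1 : i.1 < p.length
    · have : (i + 1).1 = i.1 + 1 := Fin.val_add_one_of_lt (Fin.lt_def.2 h1)
      simp only [h1, dif_pos, this]
      exact hc i h1
    · have hi := i.2
      obtain rfl : i = Fin.last p.length := Fin.ext (by simp; omega)
      simp only [Fin.last_add_one, Fin.val_last, lt_irrefl, dif_neg, not_false_eq_true,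
        SimpleGraph.Walk.getVert_length, Fin.val_zero, SimpleGraph.Walk.getVert_zero]
      exact huv.symm

/-- If the removal of `J` destroys all cycles and the darts at `J` are fixed points of `f`, then
the edges join the cycles of `f` like a forest. -/
theorem isForestOn_univ_of_not_hasCycle
    (hb : ∀ e : ↥G.edgeSet, G.IsLink e.1 (b (e, false)) (b (e, true)))
    {f : Perm G.HalfEdge} {J : Set α} (hJ : ∀ d, b d ∈ J → f d = d) (hf : ∀ d, b (f d) = b d)
    (hac : ¬ (G.deleteVerts J).HasCycle) : f.IsForestOn Finset.univ := by
  classical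
  -- Edges avoiding `J` come first: one that failed to merge would have its ends joined by inserted
  -- edges and so close a cycle outside `J`.
  have hin : ∀ S : Finset ↥G.edgeSet, (∀ e ∈ S, ∀ c, b (e, c) ∉ J) → f.IsForestOn S := by
    intro S
    induction S using Finset.induction_on with
    | empty => exact fun _ => isForestOn_empty f
    | insert e S he ih =>
      intro hS
      refine ((ih fun e he' => hS e (Finset.mem_insert_of_mem he')).insert_iff he).2 fun hs => hac ?_
      have hlink : ∀ e' ∈ insert e S, ∀ c, (G.deleteVerts J).IsLink e'.1 (b (e', c)) (b (e', !c)) :=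
        fun e' he' c => (deleteVerts_isLink _ _).2
          ⟨isLink_base_not hb (e', c), hS e' he' c, hS e' he' _⟩
      refine hasCycle_of_reachable (S := Subtype.val '' (S : Set ↥G.edgeSet)) (e := e.1) ?_
        (hlink e (Finset.mem_insert_self _ _) false) ?_
      · rintro ⟨e', he', h⟩
        exact he (Subtype.val_injective h ▸ he')
      · refine hs.induction_on (P := fun z => SimpleGraph.Reachable _ _ (b z))
          (SimpleGraph.Reachable.refl _) fun z hz => hz.trans ?_
        rw [mul_apply, hf]
        by_cases hzS : z.1 ∈ S
        · rw [flipOn_apply_of_mem hzS]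
          -- `SimpleGraph.fromRel` has no loops, so a loop edge is handled as a trivial step.
          by_cases hzz : b z = b (z.1, !z.2)
          · rw [← hzz]
          · refine SimpleGraph.Adj.reachable ((SimpleGraph.fromRel_adj _ _ _).2 ⟨hzz, Or.inl ?_⟩)
            exact ⟨z.1.1, ⟨z.1, hzS, rfl⟩, hlink z.1 (Finset.mem_insert_of_mem hzS) z.2⟩
        · rw [flipOn_apply_of_notMem hzS]
  let E₁ : Finset ↥G.edgeSet := Finset.univ.filter fun e => ∀ c, b (e, c) ∉ J
  have hout : ∀ T : Finset ↥G.edgeSet, f.IsForestOn (T ∪ E₁) := by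
    intro T
    induction T using Finset.induction_on with
    | empty =>
      rw [Finset.empty_union]
      exact hin _ fun e he => (Finset.mem_filter.1 he).2
    | insert e T he ih =>
      rw [Finset.insert_union]
      by_cases heT : e ∈ T ∪ E₁
      · rwa [Finset.insert_eq_of_mem heT]
      · refine (ih.insert_iff heT).2 ?_
        have : ¬ ∀ c, b (e, c) ∉ J := fun h =>
          heT (Finset.mem_union_right _ (Finset.mem_filter.2 ⟨Finset.mem_univ _, h⟩))
        push Not at this
        obtain ⟨c, hc⟩ := this
        -- The dart at `J` is still a cycle of its own, so its edge is pendant and merges.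
        have hfix : (f * flipOn (T ∪ E₁)) (e, c) = (e, c) := by
          rw [mul_apply, flipOn_apply_of_notMem heT, hJ _ hc]
        cases c
        · exact not_sameCycle_of_apply_eq_self hfix (by simp)
        · exact fun h => not_sameCycle_of_apply_eq_self hfix (by simp) h.symm
  have := hout Finset.univ
  rwa [Finset.union_eq_left.2 (Finset.subset_univ _)] at this

end Forest

end

end Graph

/-! ### From decycling sets to embeddings: splitting and merging vertices -/

namespace Graph

open Equiv Equiv.Perm

section

variable {α : Type*} {β : Type*} {G : Graph α β} {b : G.HalfEdge → α}

open Classical in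
/-- The vertices of the graph in which each vertex in `J` is split into vertices of degree `1`. -/
noncomputable def splitBase (b : G.HalfEdge → α) (J : Set α) (d : G.HalfEdge) : α ⊕ G.HalfEdge :=
  if b d ∈ J then Sum.inr d else Sum.inl (b d)

theorem splitBase_of_mem {J : Set α} {d : G.HalfEdge} (h : b d ∈ J) :
    splitBase b J d = Sum.inr d := if_pos h

theorem splitBase_of_notMem {J : Set α} {d : G.HalfEdge} (h : b d ∉ J) :
    splitBase b J d = Sum.inl (b d) := if_neg h

theorem base_eq_of_splitBase_eq {J : Set α} {d d' : G.HalfEdge}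
    (h : splitBase b J d = splitBase b J d') : b d = b d' := by
  unfold splitBase at h
  split_ifs at h
  · rw [Sum.inr_injective h]
  · exact Sum.inl_injective h

theorem apply_eq_of_base_mem {J : Set α} {f : Perm G.HalfEdge}
    (hf : ∀ d d', f.SameCycle d d' ↔ splitBase b J d = splitBase b J d') {d : G.HalfEdge}
    (h : b d ∈ J) : f d = d := by
  have h1 := (hf d (f d)).1 (sameCycle_apply_right.2 (SameCycle.refl _ _))
  have h2 := base_eq_of_splitBase_eq h1
  rw [splitBase_of_mem h, splitBase_of_mem (h2 ▸ h)] at h1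
  exact (Sum.inr_injective h1).symm

theorem CellularEmbedding.cycleCount_rot (R : G.CellularEmbedding) (hcubic : G.IsCubic) :
    R.rot.cycleCount = G.vertexSet.ncard := by
  rw [cycleCount_eq_card_range R.sameCycle_rot_iff, range_base R.isLink_base hcubic]

variable [Fintype ↥G.edgeSet] [DecidableEq ↥G.edgeSet]

/-- Three vertices of degree `1` are merged into a vertex of degree `3`. -/
theorem sameCycle_threeCycle_mul_iff {J : Set α} {v : α} (hv : v ∉ J) {f : Perm G.HalfEdge}
    (hf : ∀ d d', f.SameCycle d d' ↔ splitBase b (insert v J) d = splitBase b (insert v J) d')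
    {x y z : G.HalfEdge} (hxy : x ≠ y) (hxz : x ≠ z) (hyz : y ≠ z)
    (hxyz : ∀ d, b d = v ↔ d = x ∨ d = y ∨ d = z) :
    (∀ d d', (swap x z * (swap x y * f)).SameCycle d d' ↔ splitBase b J d = splitBase b J d') ∧
      (swap x z * (swap x y * f)).cycleCount + 2 = f.cycleCount := by
  have hx : b x = v := (hxyz x).2 (by simp)
  have hy : b y = v := (hxyz y).2 (by simp)
  have hz : b z = v := (hxyz z).2 (by simp)
  have hfix : ∀ d, b d = v → f d = d := fun d hd =>
    apply_eq_of_base_mem hf (hd ▸ Set.mem_insert _ _)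
  obtain ⟨h1, h2, h3, h4⟩ := cycleCount_threeCycle_mul hxy hxz hyz (hfix x hx) (hfix z hz)
  refine ⟨fun d d' => ⟨fun h => ?_, fun h => ?_⟩, h1⟩
  · have hs : ∀ u w d : G.HalfEdge, b u = v → b w = v →
        splitBase b J (swap u w d) = splitBase b J d := by
      intro u w d hu hw
      rw [swap_apply_def]
      split_ifs with e1 e2
      · rw [e1, splitBase_of_notMem (by rwa [hw]), splitBase_of_notMem (by rwa [hu]), hu, hw]
      · rw [e2, splitBase_of_notMem (by rwa [hu]), splitBase_of_notMem (by rwa [hw]), hu, hw]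
      · rfl
    refine (h.apply_eq (p := splitBase b J) fun d => ?_).symm
    rw [mul_apply, mul_apply, hs _ _ _ hx hz, hs _ _ _ hx hy]
    have h5 := (hf d (f d)).1 (sameCycle_apply_right.2 (SameCycle.refl _ _))
    by_cases hd : b d ∈ insert v J
    · rw [apply_eq_of_base_mem hf hd]
    · have h6 := base_eq_of_splitBase_eq h5
      rw [splitBase_of_notMem (h6 ▸ fun h => hd (Set.mem_insert_of_mem _ h)),
        splitBase_of_notMem fun h => hd (Set.mem_insert_of_mem _ h), h6]
  · have hb := base_eq_of_splitBase_eq h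
    by_cases hd : b d = v
    · have hall : ∀ d, b d = v → (swap x z * (swap x y * f)).SameCycle x d := by
        intro d hd
        rcases (hxyz d).1 hd with rfl | rfl | rfl
        exacts [SameCycle.refl _ _, h3, h4]
      exact (hall d hd).symm.trans (hall d' (hb ▸ hd))
    · refine h2 _ _ ((hf d d').2 ?_)
      by_cases hJ : b d ∈ J
      · rw [splitBase_of_mem hJ, splitBase_of_mem (hb ▸ hJ)] at h
        rw [Sum.inr_injective h]
      · have hn : b d ∉ insert v J := by simp [hd, hJ]
        rw [splitBase_of_notMem hn, splitBase_of_notMem (hb ▸ hn), hb]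

/-- Split vertices of degree `3` can be merged again without an increase of the number of faces. -/
theorem exists_merge (hb : ∀ e : ↥G.edgeSet, G.IsLink e.1 (b (e, false)) (b (e, true)))
    (hcubic : G.IsCubic) (J : Finset α) (hJ : (J : Set α) ⊆ G.vertexSet) (f : Perm G.HalfEdge)
    (hf : ∀ d d', f.SameCycle d d' ↔ splitBase b J d = splitBase b J d') :
    ∃ f' : Perm G.HalfEdge, (∀ d d', f'.SameCycle d d' ↔ b d = b d') ∧
      f'.cycleCount + 2 * J.card = f.cycleCount ∧
      (f' * flipOn Finset.univ).cycleCount ≤ (f * flipOn Finset.univ).cycleCount := by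
  classical
  induction J using Finset.induction_on generalizing f with
  | empty =>
    refine ⟨f, fun d d' => ?_, by simp, le_rfl⟩
    rw [hf, splitBase_of_notMem (by simp), splitBase_of_notMem (by simp)]
    exact Sum.inl_injective.eq_iff
  | insert v J hv ih =>
    rw [Finset.coe_insert] at hJ hf
    obtain ⟨x, y, z, hxy, hxz, hyz, hS⟩ := Set.ncard_eq_three.1
      (ncard_setOf_base_eq hb hcubic (hJ (Set.mem_insert _ _)))
    have hxyz : ∀ d, b d = v ↔ d = x ∨ d = y ∨ d = z := fun d => by
      simpa using Set.ext_iff.1 hS d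
    have hv' : v ∉ (J : Set α) := hv
    have key : ∃ f₁ : Perm G.HalfEdge,
        (∀ d d', f₁.SameCycle d d' ↔ splitBase b J d = splitBase b J d') ∧
        f₁.cycleCount + 2 = f.cycleCount ∧
        (f₁ * flipOn Finset.univ).cycleCount ≤ (f * flipOn Finset.univ).cycleCount := by
      -- The choice is between the two cyclic orders of the three darts at `v`.
      rcases exists_threeCycle_mul_cycleCount_le (f * flipOn Finset.univ) hxy hxz with h | h
      · obtain ⟨h1, h2⟩ := sameCycle_threeCycle_mul_iff hv' hf hxy hxz hyz hxyz
        exact ⟨_, h1, h2, by rwa [mul_assoc, mul_assoc]⟩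
      · obtain ⟨h1, h2⟩ := sameCycle_threeCycle_mul_iff hv' hf hxy.symm hyz hxz
          fun d => (hxyz d).trans (by tauto)
        exact ⟨_, h1, h2, by rwa [mul_assoc, mul_assoc]⟩
    obtain ⟨f₁, h1, h2, h3⟩ := key
    obtain ⟨f', h4, h5, h6⟩ := ih ((Set.subset_insert _ _).trans hJ) f₁ h1
    exact ⟨f', h4, by rw [Finset.card_insert_of_notMem hv]; omega, h6.trans h3⟩

theorem halfEdgeFlip_eq : G.halfEdgeFlip = flipOn Finset.univ := by
  ext1 d
  rw [flipOn_univ_apply]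
  rfl

theorem CellularEmbedding.faceCount_eq [Nonempty G.HalfEdge] (R : G.CellularEmbedding) :
    R.faceCount = (R.rot * flipOn Finset.univ).cycleCount := by
  have h := one_le_cycleCount (R.rot * flipOn Finset.univ)
  unfold CellularEmbedding.faceCount CellularEmbedding.faceTrace
  rw [halfEdgeFlip_eq]
  exact max_eq_right h

/-- The Euler characteristic is even. -/
theorem CellularEmbedding.faceCount_parity [Nonempty G.HalfEdge] (R : G.CellularEmbedding)
    (hcubic : G.IsCubic) :
    R.faceCount % 2 = (G.vertexSet.ncard + G.edgeSet.ncard) % 2 := by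
  rw [R.faceCount_eq, cycleCount_mul_flipOn_parity, R.cycleCount_rot hcubic, Finset.card_univ,
    ← Nat.card_eq_fintype_card, Nat.card_coe_set_eq]

/-- A decycling set yields an embedding with few faces. -/
theorem IsDecyclingSet.exists_faceCount_le [Nonempty G.HalfEdge] (hcubic : G.IsCubic)
    (hV : G.vertexSet.Finite) {J : Set α} (hJ : G.IsDecyclingSet J) :
    ∃ R : G.CellularEmbedding,
      R.faceCount + G.edgeSet.ncard ≤ G.vertexSet.ncard + 2 * J.ncard := by
  obtain ⟨b, hb⟩ := exists_base G
  -- `f` rotates the split graph. The order chosen at vertices outside `J` is irrelevant: in a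
  -- forest the face count depends only on the number of cycles and edges.
  obtain ⟨f, hf⟩ := exists_sameCycle_iff (splitBase b J)
  have hF : f.IsForestOn Finset.univ := by
    refine isForestOn_univ_of_not_hasCycle hb (fun d => apply_eq_of_base_mem hf) (fun d => ?_) hJ.2
    exact (base_eq_of_splitBase_eq
      ((hf d (f d)).1 (sameCycle_apply_right.2 (SameCycle.refl _ _)))).symm
  have hfin : J.Finite := hV.subset hJ.1
  obtain ⟨f', h1, h2, h3⟩ := exists_merge hb hcubic hfin.toFinset (by simpa using hJ.1) f
    (by simpa using hf)
  let R : G.CellularEmbedding := ⟨b, hb, f', h1⟩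
  refine ⟨R, ?_⟩
  have h4 : R.rot.cycleCount = _ := R.cycleCount_rot hcubic
  have h5 : f'.cycleCount = G.vertexSet.ncard := h4
  have h6 : R.faceCount = (f' * flipOn Finset.univ).cycleCount := R.faceCount_eq
  unfold IsForestOn at hF
  rw [Finset.card_univ, ← Nat.card_eq_fintype_card, Nat.card_coe_set_eq] at hF
  rw [← Set.ncard_eq_toFinset_card _ hfin] at h2
  omega

end

end Graph

/-! ### From embeddings with few faces to decycling sets -/

namespace Graph

open Equiv Equiv.Perm

section

variable {α : Type*} {β : Type*} {G : Graph α β}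

namespace CellularEmbedding

theorem base_rot (R : G.CellularEmbedding) (d : G.HalfEdge) : R.base (R.rot d) = R.base d :=
  ((R.sameCycle_rot_iff _ _).1 (sameCycle_apply_left.2 (SameCycle.refl _ _)))

theorem rot_spec [Finite G.HalfEdge] (R : G.CellularEmbedding) (hcubic : G.IsCubic)
    (d : G.HalfEdge) :
    R.rot (R.rot (R.rot d)) = d ∧ R.rot d ≠ d ∧ R.rot (R.rot d) ≠ d ∧
      ∀ d', R.base d' = R.base d → d' = d ∨ d' = R.rot d ∨ d' = R.rot (R.rot d) := by
  set f := R.rot with hf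
  have hcard := ncard_setOf_base_eq R.isLink_base hcubic (base_mem R.isLink_base d)
  have hpair : ¬ {d' | R.base d' = R.base d} ⊆ {d, f d} := fun h => by
    have h1 := Set.ncard_le_ncard h
    have h2 := Set.ncard_insert_le d {f d}
    rw [Set.ncard_singleton] at h2
    omega
  have h2 : f (f d) ≠ d := fun h => hpair fun d' hd' =>
    ((R.sameCycle_rot_iff d d').2 (Eq.symm hd')).induction_on
      (P := fun z => z = d ∨ z = f d) (Or.inl (Eq.refl _)) (by
        rintro z (rfl | rfl)
        exacts [Or.inr rfl, Or.inl h])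
  have h1 : f d ≠ d := fun h => h2 (by rw [h, h])
  have hS : ({d, f d, f (f d)} : Set G.HalfEdge) = {d' | R.base d' = R.base d} := by
    refine Set.eq_of_subset_of_ncard_le ?_ ?_
    · rintro d' (rfl | rfl | rfl)
      exacts [rfl, R.base_rot _, (R.base_rot _).trans (R.base_rot _)]
    · rw [hcard]
      refine (Set.ncard_eq_three.2 ⟨d, f d, f (f d), h1.symm, h2.symm, ?_, rfl⟩).ge
      exact fun h => h1 (f.injective h).symm
  have hmem : ∀ d', R.base d' = R.base d → d' = d ∨ d' = f d ∨ d' = f (f d) := fun d' hd' => by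
    simpa using (Set.ext_iff.1 hS d').2 hd'
  refine ⟨?_, h1, h2, hmem⟩
  rcases hmem (f (f (f d))) (by rw [R.base_rot, R.base_rot, R.base_rot]) with h | h | h
  · exact h
  · exact absurd (f.injective h) h2
  · exact absurd (f.injective (f.injective h)) h1

variable [Fintype ↥G.edgeSet] [DecidableEq ↥G.edgeSet]

/-- If a splitting of the vertices in `J` leaves a single face, then `J` can be extended to a
decycling set by splitting further vertices. -/
theorem exists_isDecyclingSet_of_cycleCount_eq_one [Nonempty G.HalfEdge] (R : G.CellularEmbedding)
    (hcubic : G.IsCubic) (f : Perm G.HalfEdge) (J : Finset α) (hJV : (J : Set α) ⊆ G.vertexSet)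
    (hout : ∀ d, R.base d ∉ J → f d = R.rot d)
    (hin : ∀ d, R.base d ∈ J → R.base (f d) = R.base d ∧ f (f d) = d)
    (hone : (f * flipOn Finset.univ).cycleCount = 1) :
    ∃ J' : Set α, G.IsDecyclingSet J' ∧
      2 * J'.ncard + f.cycleCount = G.edgeSet.ncard + 1 + 2 * J.card := by
  classical
  have hcardE : Fintype.card ↥G.edgeSet = G.edgeSet.ncard := by
    rw [← Nat.card_eq_fintype_card, Nat.card_coe_set_eq]
  -- `N` is the distance to a forest, where `f` has `|E| + 1` cycles; each split lowers it by 2.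
  obtain ⟨N, hN⟩ : ∃ N, f.cycleCount + N = G.edgeSet.ncard + 1 := by
    refine Nat.le.dest ?_
    have := cycleCount_le_mul_flipOn f Finset.univ
    rw [Finset.card_univ] at this
    omega
  induction N using Nat.strong_induction_on generalizing f J with
  | _ N ih =>
  rcases N.eq_zero_or_pos with rfl | hpos
  · refine ⟨J, ⟨hJV, ?_⟩, by rw [Set.ncard_coe_finset]; omega⟩
    have hF : f.IsForestOn Finset.univ := by
      unfold IsForestOn
      rw [Finset.card_univ]
      omega
    refine not_hasCycle_deleteVerts R.isLink_base hF fun d d' hdd' hd => ?_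
    have := ((R.sameCycle_rot_iff d d').2 hdd').induction_on
      (P := fun z => f.SameCycle d z ∧ R.base z = R.base d) ⟨SameCycle.refl _ _, rfl⟩ ?_
    · exact this.1
    · rintro z ⟨h1, h2⟩
      refine ⟨?_, (R.base_rot z).trans h2⟩
      rw [← hout z (by rw [h2]; exact hd)]
      exact sameCycle_apply_right.2 h1
  have hrot : ∀ d, R.base d ∉ J →
      f d = R.rot d ∧ f (f d) = R.rot (R.rot d) ∧ f (f (f d)) = R.rot (R.rot (R.rot d)) := by
    intro d hd
    have h1 := hout d hd
    have h2 := hout (R.rot d) (by rwa [R.base_rot])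
    have h3 := hout (R.rot (R.rot d)) (by rwa [R.base_rot, R.base_rot])
    exact ⟨h1, by rw [h1, h2], by rw [h1, h2, h3]⟩
  have hbase : ∀ d, R.base (f d) = R.base d := by
    intro d
    by_cases hd : R.base d ∈ J
    · exact (hin d hd).1
    · rw [hout d hd, R.base_rot]
  have : Nonempty ↥G.edgeSet := Nonempty.map Prod.fst ‹_›
  obtain ⟨d, hd3, hd1, hd2, hone'⟩ := exists_split_cycleCount_eq_one hone (by omega) fun d => by
    by_cases hd : R.base d ∈ J
    · exact Or.inl (hin d hd).2
    · right
      rw [(hrot d hd).2.2, (R.rot_spec hcubic d).1]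
  -- Vertices in `J` carry only cycles of length at most 2, so none is split a second time.
  have hdJ : R.base d ∉ J := fun h => hd2 (hin d h).2
  set f' := swap d (f d) * (swap d (f (f d)) * f) with hf'
  have hd12 : f d ≠ f (f d) := fun h => hd1 (f.injective h).symm
  have hfix : ∀ x, R.base x = R.base d → f' x = x := by
    intro x hx
    have := (R.rot_spec hcubic d).2.2.2 x hx
    rw [← (hrot d hdJ).2.1, ← (hrot d hdJ).1] at this
    rcases this with h | h | h <;> rw [h, hf', mul_apply, mul_apply]
    · rw [swap_apply_of_ne_of_ne hd1 hd12, swap_apply_right]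
    · rw [swap_apply_right, swap_apply_left]
    · rw [hd3, swap_apply_left, swap_apply_of_ne_of_ne hd2 hd12.symm]
  have hkeep : ∀ x, R.base x ≠ R.base d → f' x = f x := by
    intro x hx
    have h1 : f x ≠ d := fun h => hx (by rw [← hbase x, h])
    have h2 : f x ≠ f d := fun h => hx (by rw [f.injective h])
    have h3 : f x ≠ f (f d) := fun h => hx (by rw [f.injective h, hbase])
    rw [hf', mul_apply, mul_apply, swap_apply_of_ne_of_ne h1 h3, swap_apply_of_ne_of_ne h1 h2]
  have hcount : f'.cycleCount = f.cycleCount + 2 := by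
    -- The count is obtained by undoing the split: merging the three fixed points of `f'` gives back
    -- `f`.
    have h := (cycleCount_threeCycle_mul (f := f') hd1.symm hd2.symm hd12 (hfix d rfl)
      (hfix (f (f d)) (by rw [hbase, hbase]))).1
    rw [hf', ← mul_assoc (swap d (f d)) (swap d (f d)), swap_mul_self, one_mul, ← mul_assoc,
      swap_mul_self, one_mul, ← hf'] at h
    exact h.symm
  -- This bound shows `N ≥ 2`, so `N - 2` below is a true subtraction.
  have hle := cycleCount_le_mul_flipOn f' Finset.univ
  rw [Finset.card_univ, hone', hcardE] at hle
  obtain ⟨J', h1, h2⟩ := ih (N - 2) (by omega) f' (insert (R.base d) J)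
    (by
      rw [Finset.coe_insert]
      exact Set.insert_subset (base_mem R.isLink_base d) hJV)
    (fun x hx => by
      rw [Finset.mem_insert, not_or] at hx
      rw [hkeep x hx.1, hout x hx.2])
    (fun x hx => by
      by_cases hxd : R.base x = R.base d
      · rw [hfix x hxd, hfix x hxd]
        exact ⟨rfl, rfl⟩
      · have hxJ := (Finset.mem_insert.1 hx).resolve_left hxd
        rw [hkeep x hxd, hkeep (f x) (by rwa [hbase])]
        exact hin x hxJ)
    hone' (by omega)
  rw [Finset.card_insert_of_notMem hdJ] at h2
  exact ⟨J', h1, by omega⟩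

/-- If there are at least two faces, then two faces meet at some vertex. -/
theorem exists_not_sameCycle_rot [Nonempty G.HalfEdge] (R : G.CellularEmbedding)
    (hconn : G.IsConnected) (h : (R.rot * flipOn Finset.univ).cycleCount ≠ 1) :
    ∃ d, ¬ (R.rot * flipOn Finset.univ).SameCycle d (R.rot d) := by
  set φ := R.rot * flipOn Finset.univ with hφ
  by_contra! hall
  have hbase : ∀ d d', R.base d = R.base d' → φ.SameCycle d d' := fun d d' hd =>
    ((R.sameCycle_rot_iff d d').2 hd).of_forall hall
  have hflip : ∀ d : G.HalfEdge, φ.SameCycle d (d.1, !d.2) := by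
    intro d
    have h1 : φ.SameCycle d (φ d) := sameCycle_apply_right.2 (SameCycle.refl _ _)
    refine h1.trans (hbase _ _ ?_)
    rw [hφ, mul_apply, flipOn_univ_apply, R.base_rot]
  have hsame : ∀ d d', φ.SameCycle d d' := by
    intro d d'
    have hpath := hconn.2 _ (base_mem R.isLink_base d) _ (base_mem R.isLink_base d')
    have key : ∀ w, Relation.ReflTransGen G.Adj (R.base d) w →
        ∀ x, R.base x = w → φ.SameCycle d x := by
      intro w hw
      induction hw with
      | refl => exact fun x hx => hbase d x hx.symm
      | tail _ hadj ih =>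
        intro x hx
        obtain ⟨e, he⟩ := hadj
        obtain ⟨y, -, hy1, hy2⟩ := exists_base_eq R.isLink_base he
        exact ((ih y hy1).trans (hflip y)).trans (hbase _ _ (hy2.trans hx.symm))
    exact key _ hpath d' rfl
  refine h ?_
  rw [cycleCount_eq_card_range (p := fun _ => ()) fun x y => iff_of_true (hsame x y) rfl,
    Set.range_const, Set.ncard_singleton]

/-- An embedding with at most two faces yields a small decycling set. -/
theorem exists_isDecyclingSet [Nonempty G.HalfEdge] (R : G.CellularEmbedding)
    (hconn : G.IsConnected) (hcubic : G.IsCubic) (hR : R.faceCount ≤ 2) :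
    ∃ J : Set α, G.IsDecyclingSet J ∧
      2 * J.ncard + G.vertexSet.ncard = G.edgeSet.ncard + R.faceCount := by
  have hn := R.cycleCount_rot hcubic
  have hpos := one_le_cycleCount (R.rot * flipOn Finset.univ)
  rw [R.faceCount_eq] at *
  by_cases h1 : (R.rot * flipOn Finset.univ).cycleCount = 1
  · obtain ⟨J, hJ, hc⟩ := R.exists_isDecyclingSet_of_cycleCount_eq_one hcubic R.rot ∅
      (by simp) (fun _ _ => rfl) (by simp) h1
    rw [Finset.card_empty] at hc
    exact ⟨J, hJ, by omega⟩
  · obtain ⟨d, hd⟩ := R.exists_not_sameCycle_rot hconn h1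
    obtain ⟨hd3, hd1, hd2, hmem⟩ := R.rot_spec hcubic d
    have hd12 : R.rot d ≠ R.rot (R.rot d) := fun h => hd1 (R.rot.injective h).symm
    -- Detaching `d` turns it into a vertex of degree 1 and leaves one of degree 2. This adds one
    -- cycle to the rotation and merges the two faces, so the one-face case applies with this vertex
    -- already in `J`.
    have e1 := cycleCount_swap_mul_add_one hd
    have e2 := cycleCount_swap_mul
      ((R.sameCycle_rot_iff d (R.rot d)).2 (R.base_rot d).symm) hd1.symm
    have hd0 : (swap d (R.rot d) * R.rot) d = d := by
      rw [mul_apply, swap_apply_right]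
    have hd0' : (swap d (R.rot d) * R.rot) (R.rot d) = R.rot (R.rot d) := by
      rw [mul_apply, swap_apply_of_ne_of_ne hd2 hd12.symm]
    have hd0'' : (swap d (R.rot d) * R.rot) (R.rot (R.rot d)) = R.rot d := by
      rw [mul_apply, hd3, swap_apply_left]
    obtain ⟨J, hJ, hc⟩ := R.exists_isDecyclingSet_of_cycleCount_eq_one hcubic
      (swap d (R.rot d) * R.rot) {R.base d} (by simpa using base_mem R.isLink_base d)
      (fun x hx => by
        rw [Finset.mem_singleton] at hx
        have h1 : R.rot x ≠ d := fun h => hx (by rw [← R.base_rot x, h])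
        have h2 : R.rot x ≠ R.rot d := fun h => hx (by rw [R.rot.injective h])
        rw [mul_apply, swap_apply_of_ne_of_ne h1 h2])
      (fun x hx => by
        rw [Finset.mem_singleton] at hx
        rcases hmem x hx with rfl | rfl | rfl
        · rw [hd0, hd0]
          exact ⟨rfl, rfl⟩
        · rw [hd0', hd0'']
          exact ⟨R.base_rot _, rfl⟩
        · rw [hd0'', hd0']
          exact ⟨(R.base_rot _).symm, rfl⟩)
      (by rw [mul_assoc]; omega)
    rw [Finset.card_singleton] at hc
    exact ⟨J, hJ, by omega⟩

end CellularEmbedding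

end

end Graph

/-! ### The numerical bound and the theorem -/

theorem Nat.ceil_add_two_div_four (n : ℕ) : ⌈((n : ℚ) + 2) / 4⌉₊ = (n + 5) / 4 := by
  apply le_antisymm
  · rw [Nat.ceil_le, div_le_iff₀ (by norm_num)]
    have : n + 2 ≤ (n + 5) / 4 * 4 := by omega
    exact_mod_cast this
  · have h := Nat.le_ceil (((n : ℚ) + 2) / 4)
    rw [div_le_iff₀ (by norm_num)] at h
    have : n + 2 ≤ ⌈((n : ℚ) + 2) / 4⌉₊ * 4 := by exact_mod_cast h
    omega

theorem theorem3p8 {α : Type*} {β : Type*} (G : Graph α β)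
    (hV : G.vertexSet.Finite) (hE : G.edgeSet.Finite)
    (hconn : G.IsConnected) (hcubic : G.IsCubic) (n : ℕ) (hn : G.vertexSet.ncard = n) :
    ⌈((n : ℚ) + 2) / 4⌉₊ ≤ G.decyclingNumber ∧
      (G.decyclingNumber = ⌈((n : ℚ) + 2) / 4⌉₊ ↔ G.IsUpperEmbeddable) := by
  classical
  have : Fintype ↥G.edgeSet := hE.fintype
  have : Nonempty G.HalfEdge := by
    obtain ⟨b, hb⟩ := Graph.exists_base G
    obtain ⟨v, hv⟩ := hconn.1
    rw [← Graph.range_base hb hcubic] at hv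
    exact ⟨hv.choose⟩
  have hnE := hcubic.two_mul_ncard_edgeSet hV hE
  have hface : ∀ R : G.CellularEmbedding, 1 ≤ R.faceCount := fun R => le_max_left _ _
  have hparity := fun R : G.CellularEmbedding => R.faceCount_parity hcubic
  have hne : {k : ℕ | ∃ J : Set α, G.IsDecyclingSet J ∧ J.ncard = k}.Nonempty := by
    refine ⟨_, G.vertexSet, ⟨subset_rfl, ?_⟩, rfl⟩
    rintro ⟨k, _, x, e, -, -, h⟩
    have := (h 0).left_mem
    simp at this
  obtain ⟨J, hJ, hJc⟩ : ∃ J : Set α, G.IsDecyclingSet J ∧ J.ncard = G.decyclingNumber :=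
    Nat.sInf_mem hne
  obtain ⟨R, hR⟩ := hJ.exists_faceCount_le hcubic hV
  have hR1 := hface R
  have hRp := hparity R
  rw [Nat.ceil_add_two_div_four]
  -- As `2|E| = 3n`, the estimate `hR` bounds the number of faces by `2 * J.ncard - n / 2`, and
  -- there is at least one face.
  refine ⟨by omega, fun heq => ⟨⟨R, ?_⟩, ?_⟩, ?_⟩
  -- Equality leaves at most two faces, and parity decides between one and two.
  · unfold Graph.CellularEmbedding.HasGenus Graph.bettiNumber
    omega
  · rintro h ⟨R', hR'⟩
    have := hface R'
    unfold Graph.CellularEmbedding.HasGenus at hR'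
    unfold Graph.bettiNumber
    omega
  · rintro ⟨⟨R', hR'⟩, -⟩
    unfold Graph.CellularEmbedding.HasGenus Graph.bettiNumber at hR'
    -- Genus `⌊β/2⌋` means `β + 1 - 2⌊β/2⌋` faces, that is, one or two.
    obtain ⟨J', hJ', hc⟩ := R'.exists_isDecyclingSet hconn hcubic (by omega)
    have hle : G.decyclingNumber ≤ J'.ncard := Nat.sInf_le ⟨J', hJ', rfl⟩
    have := hface R'
    omega
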